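/- \textbf{Setting.} Let $\mathcal A$ be a nonempty finite action set and let the outcome space $\mathcal Y$ be a Euclidean space or a compact subset of one. Given action $a$, outcomes are drawn from $Q^*(\cdot|a)$, which has a positive density $q^*(\cdot|a)$ with respect to a common measure $\nu$; the payoff satisfies $u(a,\cdot)\in L^1(Q^*(\cdot|a))$ for all $a$. Fix a discount factor $\delta\in[0,1)$ and a switching threshold $\alpha>1$. Let $\Theta$ be the set of models $\theta$ consisting of a nonempty finite subset $\Omega^\theta$ of a Euclidean space and conditional distributions $Q^\theta(\cdot|a,\omega)$ with positive densities $q^\theta(\cdot|a,\omega)$ with respect to $\nu$ such that, for all $a\in\mathcal A$ and $\omega\in\Omega^\theta$, $u(a,\cdot)\in L^1(Q^\theta(\cdot|a,\omega))$ and $|\ln (q^*(\cdot|a)/q^\theta(\cdot|a,\omega))|\le g_a$ holds $Q^*(\cdot|a)$-a.s. for some $g_a\in L^2(\nu)$. The model $\theta$ is \emph{correctly specified} if there is $\omega\in\Omega^\theta$ with $q^\theta(\cdot|a,\omega)=q^*(\cdot|a)$ ($\nu$-a.e.) for all $a\in\mathcal A$. For a belief $\pi\in\Delta\Omega^\theta$,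 let $B^\theta(a,y,\pi)$ be its Bayesian update after $(a,y)$, and let $U^\theta$ be the bounded measurable solution of $$U^\theta(\pi)=\max_{a\in\mathcal A}\sum_{\omega\in\Omega^\theta}\pi(\omega)\int_{\mathcal Y}\bigl[u(a,y)+\delta U^\theta(B^\theta(a,y,\pi))\bigr]q^\theta(y|a,\omega)\,\nu(dy).$$ A policy $a^\theta:\Delta\Omega^\theta\to\mathcal A$ is \emph{optimal} if it is measurable and $a^\theta(\pi)$ attains this maximum for every $\pi$. \textbf{Switching.} A switcher has an initial model $\theta$ and a competing model $\theta^c$, each with a full-support prior $\pi_0$ and an optimal policy. Her period-$0$ model choice is $m_0=\theta$. For $t\ge1$ let $l_t^{\theta'}=\sum_{\omega\in\Omega^{\theta'}}\pi_0^{\theta'}(\omega)\prod_{\tau=0}^{t-1}q^{\theta'}(y_\tau|a_\tau,\omega)$ for each of her two models $\theta'$; she sets $m_t$ equal to the model other than $m_{t-1}$ if its Bayes factor, the ratio of its likelihood $l_t$ to $l_t^{m_{t-1}}$, is greater than $\alpha$, and sets $m_t=m_{t-1}$ otherwise. In every period $t$ she plays $a_t=a^{m_t}(\pi_t^{m_t})$,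 where $\pi_t^{m_t}$ is the posterior of model $m_t$ given the full history, and observes $y_t\sim Q^*(\cdot|a_t)$, with independent draws. The model $\theta$ \emph{persists} against $\theta^c$ at these priors and policies if, with positive probability, $m_t=\theta$ for all sufficiently large $t$. The model $\theta$ is \emph{globally robust} if there exist a full-support prior $\pi_0^\theta$ and an optimal policy $a^\theta$ at which $\theta$ persists against every $\theta^c\in\Theta$ at every full-support prior $\pi_0^{\theta^c}$ and every optimal policy $a^{\theta^c}$. \textbf{Corollary.} Every correctly specified model $\theta\in\Theta$ is globally robust. -/

import Mathlib

open MeasureTheory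

noncomputable section

namespace Switcher

/-- The primitives of the decision problem: a reference measure `ν` on outcomes, the
true conditional densities `qstar a` with respect to `ν`, the flow payoff `u`, the discount
factor `δ` and the switching threshold `α`. -/
structure Environment (A Y : Type*) [MeasurableSpace Y] where
  /-- the common dominating measure -/
  ν : Measure Y
  /-- the true density of the outcome conditional on the action -/
  qstar : A → Y → ℝ
  measurable_qstar : ∀ a, Measurable (qstar a)
  qstar_pos : ∀ a y, 0 < qstar a y
  lintegral_qstar : ∀ a, ∫⁻ y, ENNReal.ofReal (qstar a y) ∂ν = 1
  /-- the flow payoff -/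
  u : A → Y → ℝ
  integrable_u : ∀ a, Integrable (u a) (ν.withDensity fun y => ENNReal.ofReal (qstar a y))
  /-- the discount factor -/
  δ : ℝ
  δ_nonneg : 0 ≤ δ
  δ_lt_one : δ < 1
  /-- the switching threshold -/
  α : ℝ
  one_lt_α : 1 < α

variable {A Y : Type*} [MeasurableSpace Y]

/-- The true data generating process `Q*(· | a)`. -/
def Environment.Qstar (E : Environment A Y) (a : A) : Measure Y :=
  E.ν.withDensity fun y => ENNReal.ofReal (E.qstar a y)

instance (E : Environment A Y) (a : A) : IsProbabilityMeasure (E.Qstar a) :=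
  ⟨by rw [Environment.Qstar, withDensity_apply _ MeasurableSet.univ, Measure.restrict_univ,
    E.lintegral_qstar]⟩

/-- The set `Θ` of admissible subjective models: a nonempty finite parameter set in a
Euclidean space, together with positive conditional densities with respect to `ν` for each
action and parameter, subject to integrability of the payoff and of the log-likelihood
ratio to the truth. -/
structure Model (E : Environment A Y) where
  /-- dimension of the ambient Euclidean space of the parameter set -/
  dim : ℕ
  /-- the parameter set -/
  params : Finset (EuclideanSpace ℝ (Fin dim))
  params_nonempty : params.Nonempty
  /-- the density of the outcome conditional on the action and the parameter -/
  q : A → params → Y → ℝ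
  measurable_q : ∀ a ω, Measurable (q a ω)
  q_pos : ∀ a ω y, 0 < q a ω y
  lintegral_q : ∀ a ω, ∫⁻ y, ENNReal.ofReal (q a ω y) ∂E.ν = 1
  integrable_u : ∀ a ω,
    Integrable (E.u a) (E.ν.withDensity fun y => ENNReal.ofReal (q a ω y))
  log_ratio_bound : ∀ a ω, ∃ g : Y → ℝ, MemLp g 2 E.ν ∧
    ∀ᵐ y ∂E.Qstar a, |Real.log (E.qstar a y / q a ω y)| ≤ g y

/-- A model is correctly specified if, at one and the same parameter, its conditional
densities agree with the true ones for every action. -/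
def Model.CorrectlySpecified {E : Environment A Y} (θ : Model E) : Prop :=
  ∃ ω : θ.params, ∀ a, E.qstar a =ᵐ[E.ν] θ.q a ω

/-- Beliefs: probability vectors on the parameter set of a model. -/
abbrev Model.Belief {E : Environment A Y} (θ : Model E) : Type :=
  stdSimplex ℝ θ.params

/-- A belief has full support if it gives positive weight to every parameter. -/
def FullSupport {E : Environment A Y} {θ : Model E} (π : θ.Belief) : Prop :=
  ∀ ω, 0 < π.1 ω

theorem Model.mix_pos {E : Environment A Y} (θ : Model E) (a : A) (y : Y) (π : θ.Belief) :
    0 < ∑ ω, π.1 ω * θ.q a ω y := by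
  have h0 : ∀ ω, 0 ≤ π.1 ω * θ.q a ω y := fun ω =>
    mul_nonneg (π.2.1 ω) (θ.q_pos a ω y).le
  refine lt_of_le_of_ne (Finset.sum_nonneg fun ω _ => h0 ω) fun h => ?_
  have hz := (Finset.sum_eq_zero_iff_of_nonneg fun ω _ => h0 ω).1 h.symm
  have h1 : ∑ ω, π.1 ω = 0 := Finset.sum_eq_zero fun ω hω =>
    (mul_eq_zero.1 (hz ω hω)).resolve_right (θ.q_pos a ω y).ne'
  rw [π.2.2] at h1
  exact one_ne_zero h1

/-- The Bayesian operator `B(a, y, π)`. -/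
def Model.bayes {E : Environment A Y} (θ : Model E) (a : A) (y : Y) (π : θ.Belief) :
    θ.Belief :=
  ⟨fun ω => π.1 ω * θ.q a ω y / ∑ ω', π.1 ω' * θ.q a ω' y,
    fun ω => div_nonneg (mul_nonneg (π.2.1 ω) (θ.q_pos a ω y).le) (θ.mix_pos a y π).le,
    by rw [← Finset.sum_div, div_self (θ.mix_pos a y π).ne']⟩

/-- The objective of the dynamic program: expected flow payoff of action `a` at belief `π`
plus discounted continuation value, with continuation value function `U`. -/
def Model.objective {E : Environment A Y} (θ : Model E) (U : θ.Belief → ℝ) (π : θ.Belief)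
    (a : A) : ℝ :=
  ∑ ω, π.1 ω * ∫ y, (E.u a y + E.δ * U (θ.bayes a y π)) * θ.q a ω y ∂E.ν

/-- `U` is the value function of the dynamic program: the (unique) bounded measurable
solution of the Bellman equation. -/
def Model.IsValueFunction {E : Environment A Y} (θ : Model E) (U : θ.Belief → ℝ) : Prop :=
  Measurable U ∧ (∃ C, ∀ π, |U π| ≤ C) ∧
    ∀ π, IsGreatest (Set.range (θ.objective U π)) (U π)

/-- The set of optimal actions at belief `π`. -/
def Model.optimalActions {E : Environment A Y} (θ : Model E) (π : θ.Belief) : Set A :=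
  {a | ∃ U, θ.IsValueFunction U ∧ ∀ b, θ.objective U π b ≤ θ.objective U π a}

/-- A pure optimal policy: a measurable selection from the optimal actions. -/
def Model.IsOptimalPolicy {E : Environment A Y} (θ : Model E) (p : θ.Belief → A) : Prop :=
  (∀ a, MeasurableSet {π | p π = a}) ∧ ∀ π, p π ∈ θ.optimalActions π

/-- The likelihood of the history `h` of length `t`, evaluated at the prior `π₀`. -/
def Model.likelihood {E : Environment A Y} (θ : Model E) (π₀ : θ.Belief) {t : ℕ}
    (h : Fin t → A × Y) : ℝ :=
  ∑ ω, π₀.1 ω * ∏ τ, θ.q (h τ).1 ω (h τ).2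

/-- The posterior after the history `h`, obtained by iterating the Bayesian operator. -/
def Model.posterior {E : Environment A Y} (θ : Model E) (π₀ : θ.Belief) :
    (t : ℕ) → (Fin t → A × Y) → θ.Belief
  | 0, _ => π₀
  | t + 1, h => θ.bayes (h (Fin.last t)).1 (h (Fin.last t)).2 (θ.posterior π₀ t (Fin.init h))

/-- What the switcher is endowed with for each of her two models, indexed by `Bool`:
`false` is the initial model, `true` is the competing model. -/
structure Endowment (E : Environment A Y) where
  model : Bool → Model E
  prior : ∀ i, (model i).Belief
  policy : ∀ i, (model i).Belief → A

namespace Endowment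

variable {E : Environment A Y} (S : Endowment E)

/-- The Bayes factor of model `i` relative to the last model choice `m`. -/
def bayesFactor (m i : Bool) {t : ℕ} (h : Fin t → A × Y) : ℝ :=
  (S.model i).likelihood (S.prior i) h / (S.model m).likelihood (S.prior m) h

open Classical in
/-- The model choice after the history `h`. The Bayes factor of the current model is `1`,
which is below the threshold, so the largest Bayes factor exceeds the threshold exactly when
that of the other model does, and the switch is then to the other model. -/
def modelChoice : (t : ℕ) → (Fin t → A × Y) → Bool
  | 0, _ => false
  | t + 1, h =>
    if E.α < S.bayesFactor (modelChoice t (Fin.init h)) (!(modelChoice t (Fin.init h))) h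
    then !(modelChoice t (Fin.init h))
    else modelChoice t (Fin.init h)

/-- The action after the history `h`: that of the policy of the current model at its
posterior. -/
def action (t : ℕ) (h : Fin t → A × Y) : A :=
  S.policy (S.modelChoice t h)
    ((S.model (S.modelChoice t h)).posterior (S.prior (S.modelChoice t h)) t h)

/-- The history up to time `t` when the potential outcome of action `a` in period `τ` is
`y (a, τ)`. -/
def history (y : A × ℕ → Y) : (t : ℕ) → Fin t → A × Y
  | 0 => Fin.elim0
  | t + 1 => Fin.snoc (α := fun _ => A × Y) (history y t)
      (S.action t (history y t), y (S.action t (history y t), t))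

end Endowment

/-- The law of the potential outcomes: independent draws, that of action `a` in each period
having law `Q*(· | a)`. -/
def Environment.outcomeLaw (E : Environment A Y) : Measure (A × ℕ → Y) :=
  Measure.infinitePi fun i : A × ℕ => E.Qstar i.1

/-- The initial model persists: with positive probability the model choice is eventually
constantly equal to it. -/
def Endowment.InitialPersists {E : Environment A Y} (S : Endowment E) : Prop :=
  0 < E.outcomeLaw {y | ∃ T, ∀ t ≥ T, S.modelChoice t (S.history y t) = false}

/-- The endowment of a switcher with initial model `θ` and competing model `θc`, with the
given priors and policies. -/
def Endowment.pair {E : Environment A Y} (θ θc : Model E) (π : θ.Belief) (πc : θc.Belief)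
    (p : θ.Belief → A) (pc : θc.Belief → A) : Endowment E where
  model := fun i => match i with | false => θ | true => θc
  prior := fun i => match i with | false => π | true => πc
  policy := fun i => match i with | false => p | true => pc

/-- `θ` persists against `θc` at the given priors and policies. -/
def PersistsAgainst {E : Environment A Y} (θ θc : Model E) (π : θ.Belief) (πc : θc.Belief)
    (p : θ.Belief → A) (pc : θc.Belief → A) : Prop :=
  (Endowment.pair θ θc π πc p pc).InitialPersists

/-- Global robustness: some full-support prior and optimal policy make `θ` persist against
every admissible model at each of its full-support priors and optimal policies. -/
def Model.GloballyRobust {E : Environment A Y} (θ : Model E) : Prop :=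
  ∃ (π : θ.Belief) (p : θ.Belief → A), FullSupport π ∧ θ.IsOptimalPolicy p ∧
    ∀ (θc : Model E) (πc : θc.Belief) (pc : θc.Belief → A),
      FullSupport πc → θc.IsOptimalPolicy pc → PersistsAgainst θ θc π πc p pc

end Switcher

end

/-! Let `ω` be the true parameter, and choose a full-support prior giving it weight `w > 1/α`. The
initial model's likelihood is then almost surely at least `w` times the true likelihood. A switch
away from it therefore requires the competitor's likelihood, relative to the truth, to exceed `c = α
* w > 1`.

That ratio is a nonnegative martingale started at `1`, however actions depend on the past
(`Model.lintegral_likelihoodRatio_snoc`, `Endowment.setLIntegral_realizedRatio_succ`). By Ville's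
inequality (`Endowment.measure_forall_realizedRatio_lt_pos`) it stays below `c` forever with
positive probability, and on that event no switch ever occurs. The prior depends only on `α` and
`ω`, so it serves against every competitor.

An optimal policy comes from a Bellman contraction and a measurable choice of maximizer
(`Model.exists_isOptimalPolicy`). -/

noncomputable section

namespace Switcher

variable {A Y : Type*} [MeasurableSpace Y]

/-! ### Optimal policies: Bellman equation and measurable selection -/

section DynamicProgramming

variable {E : Environment A Y} (θ : Model E)

theorem Model.continuous_bayes (a : A) (y : Y) : Continuous (θ.bayes a y) := by
  refine Continuous.subtype_mk (continuous_pi fun ω => ?_) _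
  have h (ω : θ.params) : Continuous fun π : θ.Belief => π.1 ω :=
    (continuous_apply ω).comp continuous_subtype_val
  exact ((h ω).mul continuous_const).div
    (continuous_finsetSum _ fun ω' _ => (h ω').mul continuous_const)
    fun π => (θ.mix_pos a y π).ne'

theorem Model.measurable_bayes_uncurry (a : A) :
    Measurable fun x : Y × θ.Belief => θ.bayes a x.1 x.2 := by
  refine Measurable.subtype_mk (measurable_pi_lambda _ fun ω => ?_)
  have h (ω : θ.params) : Measurable fun x : Y × θ.Belief => x.2.1 ω * θ.q a ω x.1 :=
    ((measurable_pi_apply ω).comp (measurable_subtype_coe.comp measurable_snd)).mul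
      ((θ.measurable_q a ω).comp measurable_fst)
  exact (h ω).div (Finset.measurable_sum _ fun ω' _ => h ω')

theorem Model.measurable_bayes (a : A) (π : θ.Belief) : Measurable fun y => θ.bayes a y π :=
  (θ.measurable_bayes_uncurry a).comp (measurable_id.prodMk measurable_const)

theorem Model.integrable_q (a : A) (ω : θ.params) : Integrable (θ.q a ω) E.ν := by
  refine ⟨(θ.measurable_q a ω).aestronglyMeasurable, ?_⟩
  rw [hasFiniteIntegral_iff_ofReal (Filter.Eventually.of_forall fun y => (θ.q_pos a ω y).le),
    θ.lintegral_q]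
  exact ENNReal.one_lt_top

theorem Model.integral_q (a : A) (ω : θ.params) : ∫ y, θ.q a ω y ∂E.ν = 1 := by
  rw [integral_eq_lintegral_of_nonneg_ae
    (Filter.Eventually.of_forall fun y => (θ.q_pos a ω y).le)
    (θ.measurable_q a ω).aestronglyMeasurable, θ.lintegral_q, ENNReal.toReal_one]

theorem Model.integrable_payoff_mul_q (a : A) (ω : θ.params) :
    Integrable (fun y => E.u a y * θ.q a ω y) E.ν := by
  have h := (integrable_withDensity_iff_integrable_smul' (θ.measurable_q a ω).ennreal_ofReal
    (Filter.Eventually.of_forall fun _ => ENNReal.ofReal_lt_top)).1 (θ.integrable_u a ω)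
  refine h.congr (Filter.Eventually.of_forall fun y => ?_)
  simp [ENNReal.toReal_ofReal (θ.q_pos a ω y).le, mul_comm]

theorem Model.integrable_continuation (U : C(θ.Belief, ℝ)) (π : θ.Belief) (a : A)
    (ω : θ.params) : Integrable (fun y => U (θ.bayes a y π) * θ.q a ω y) E.ν :=
  (θ.integrable_q a ω).bdd_mul (c := ‖U‖)
    (U.continuous.measurable.comp (θ.measurable_bayes a π)).aestronglyMeasurable
    (Filter.Eventually.of_forall fun _ => U.norm_coe_le_norm _)

theorem Model.objective_eq (U : C(θ.Belief, ℝ)) (π : θ.Belief) (a : A) :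
    θ.objective U π a = ∑ ω, π.1 ω * (∫ y, E.u a y * θ.q a ω y ∂E.ν +
      E.δ * ∫ y, U (θ.bayes a y π) * θ.q a ω y ∂E.ν) := by
  refine Finset.sum_congr rfl fun ω _ => ?_
  rw [← integral_const_mul E.δ, ← integral_add (θ.integrable_payoff_mul_q a ω)
    ((θ.integrable_continuation U π a ω).const_mul _)]
  congr 2
  ext y
  ring

/-- Dominated convergence: for a fixed outcome the update is continuous in the belief, and `‖U‖ * q`
dominates. Hence the Bellman operator preserves continuity. -/
theorem Model.continuous_objective (U : C(θ.Belief, ℝ)) (a : A) :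
    Continuous fun π => θ.objective U π a := by
  simp only [θ.objective_eq]
  refine continuous_finsetSum _ fun ω _ => ((continuous_apply ω).comp
    continuous_subtype_val).mul (continuous_const.add (continuous_const.mul ?_))
  refine continuous_of_dominated (bound := fun y => ‖U‖ * θ.q a ω y)
    (fun π => (θ.integrable_continuation U π a ω).aestronglyMeasurable)
    (fun π => Filter.Eventually.of_forall fun y => ?_)
    ((θ.integrable_q a ω).const_mul _)
    (Filter.Eventually.of_forall fun y =>
      (U.continuous.comp (θ.continuous_bayes a y)).mul continuous_const)
  rw [norm_mul, Real.norm_of_nonneg (θ.q_pos a ω y).le]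
  exact mul_le_mul_of_nonneg_right (U.norm_coe_le_norm _) (θ.q_pos a ω y).le

/-- Densities and beliefs have total mass one, so a uniform gap in continuation values is only
scaled by `δ`. The contraction bound uses this in both directions. -/
theorem Model.objective_le_add_dist (U V : C(θ.Belief, ℝ)) (π : θ.Belief) (a : A) :
    θ.objective U π a ≤ θ.objective V π a + E.δ * dist U V := by
  have hπ : E.δ * dist U V = ∑ ω, π.1 ω * (E.δ * dist U V) := by
    rw [← Finset.sum_mul, π.2.2, one_mul]
  rw [hπ, θ.objective_eq, θ.objective_eq, ← Finset.sum_add_distrib]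
  refine Finset.sum_le_sum fun ω _ => ?_
  rw [← mul_add, add_assoc, ← mul_add]
  refine mul_le_mul_of_nonneg_left ((add_le_add_iff_left _).2
    (mul_le_mul_of_nonneg_left ?_ E.δ_nonneg)) (π.2.1 ω)
  have hd : dist U V = ∫ y, dist U V * θ.q a ω y ∂E.ν := by
    rw [integral_const_mul, θ.integral_q, mul_one]
  rw [hd, ← integral_add (θ.integrable_continuation V π a ω)
    ((θ.integrable_q a ω).const_mul _)]
  refine integral_mono (θ.integrable_continuation U π a ω)
    ((θ.integrable_continuation V π a ω).add ((θ.integrable_q a ω).const_mul _)) fun y => ?_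
  have h := (abs_le.1 (ContinuousMap.dist_apply_le_dist (f := U) (g := V) (θ.bayes a y π))).2
  rw [← add_mul]
  exact mul_le_mul_of_nonneg_right (by linarith) (θ.q_pos a ω y).le

variable [Fintype A] [Nonempty A]

/-- The Bellman operator on continuous functions of the belief. -/
def Model.bellman (U : C(θ.Belief, ℝ)) : C(θ.Belief, ℝ) where
  toFun π := Finset.univ.sup' Finset.univ_nonempty (θ.objective U π)
  continuous_toFun := Continuous.finset_sup'_apply Finset.univ_nonempty
    fun a _ => θ.continuous_objective U a

theorem Model.bellman_le_add_dist (U V : C(θ.Belief, ℝ)) (π : θ.Belief) :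
    θ.bellman U π ≤ θ.bellman V π + E.δ * dist U V :=
  Finset.sup'_le Finset.univ_nonempty _ fun a ha => (θ.objective_le_add_dist U V π a).trans
    (add_le_add_left (Finset.le_sup' (θ.objective V π) ha) _)

theorem Model.bellman_contracting :
    ContractingWith ⟨E.δ, E.δ_nonneg⟩ (θ.bellman) := by
  refine ⟨E.δ_lt_one, LipschitzWith.of_dist_le_mul fun U V => ?_⟩
  refine (ContinuousMap.dist_le (mul_nonneg E.δ_nonneg dist_nonneg)).2 fun π => ?_
  have h1 := θ.bellman_le_add_dist U V π
  have h2 := θ.bellman_le_add_dist V U π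
  rw [dist_comm V U] at h2
  rw [Real.dist_eq, abs_le]
  change -(E.δ * dist U V) ≤ _ ∧ _ ≤ E.δ * dist U V
  constructor <;> linarith

/-- Banach's fixed point theorem. Continuity on the compact simplex supplies boundedness and
measurability, and later makes the sets of maximizers closed. -/
theorem Model.exists_continuous_isValueFunction :
    ∃ U : C(θ.Belief, ℝ), θ.IsValueFunction U := by
  have hU := θ.bellman_contracting.fixedPoint_isFixedPt
  set U := ContractingWith.fixedPoint _ θ.bellman_contracting
  refine ⟨U, U.continuous.measurable, ⟨‖U‖, U.norm_coe_le_norm⟩, fun π => ?_⟩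
  have hπ : U π = Finset.univ.sup' Finset.univ_nonempty (θ.objective U π) :=
    (DFunLike.congr_fun hU π).symm
  constructor
  · obtain ⟨a, -, ha⟩ := Finset.exists_mem_eq_sup' Finset.univ_nonempty (θ.objective U π)
    exact ⟨a, (hπ.trans ha).symm⟩
  · rintro _ ⟨a, rfl⟩
    rw [hπ]
    exact Finset.le_sup' _ (Finset.mem_univ a)

end DynamicProgramming

/-- Finitely many continuous functions admit a measurable selection of a maximizer. -/
theorem exists_measurable_argmax {X : Type*} [TopologicalSpace X] [MeasurableSpace X]
    [OpensMeasurableSpace X] [Finite A] [Nonempty A] (f : A → X → ℝ)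
    (hf : ∀ a, Continuous (f a)) :
    ∃ p : X → A, (∀ a, MeasurableSet {x | p x = a}) ∧ ∀ x b, f b x ≤ f (p x) x := by
  classical
  obtain ⟨e⟩ : Nonempty (A ≃ Fin (Nat.card A)) := ⟨Finite.equivFin A⟩
  let P : X → Fin (Nat.card A) → Prop := fun x n => ∀ b, f b x ≤ f (e.symm n) x
  have hP : ∀ x, ∃ n, P x n := fun x => by
    obtain ⟨a, ha⟩ := Finite.exists_max fun a => f a x
    exact ⟨e a, by simpa [P] using ha⟩
  have hm : ∀ n, MeasurableSet {x | P x n} := fun n => by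
    simp only [P, Set.ofPred_forall]
    exact MeasurableSet.iInter fun b => (isClosed_le (hf b) (hf _)).measurableSet
  -- Ties are broken by the smallest index, so each level set is a finite Boolean combination of
  -- closed sets.
  refine ⟨fun x => e.symm (Fin.find (P x) (hP x)), fun a => ?_,
    fun x => Fin.find_spec (hP x)⟩
  have : {x | e.symm (Fin.find (P x) (hP x)) = a} =
      {x | P x (e a)} ∩ ⋂ n : {n // n < e a}, {x | P x n}ᶜ := by
    ext x
    simp [Equiv.symm_apply_eq, Fin.find_eq_iff]
  rw [this]
  exact (hm _).inter (MeasurableSet.iInter fun n => (hm n).compl)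

theorem Model.exists_isOptimalPolicy {E : Environment A Y} [Finite A] [Nonempty A]
    (θ : Model E) : ∃ p, θ.IsOptimalPolicy p := by
  cases nonempty_fintype A
  obtain ⟨U, hU⟩ := θ.exists_continuous_isValueFunction
  obtain ⟨p, hp, hmax⟩ := exists_measurable_argmax (fun a π => θ.objective U π a)
    (θ.continuous_objective U)
  exact ⟨p, hp, fun π => ⟨U, hU, hmax π⟩⟩

/-! ### Resampling one coordinate of a product measure -/

section Resampling

variable {ι : Type*} [DecidableEq ι] {X : ι → Type*} [∀ i, MeasurableSpace (X i)]
  (μ : ∀ i, Measure (X i)) [∀ i, IsProbabilityMeasure (μ i)]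

theorem measurable_update_prod (i : ι) :
    Measurable fun p : (∀ i, X i) × X i => Function.update p.1 i p.2 := by
  refine measurable_pi_lambda _ fun j => ?_
  rcases eq_or_ne j i with rfl | h
  · simpa using measurable_snd
  · simpa [h] using measurable_fst.eval (a := j)

/-- Resampling one coordinate independently leaves a product measure unchanged. -/
theorem map_update_infinitePi (i : ι) :
    ((Measure.infinitePi μ).prod (μ i)).map (fun p => Function.update p.1 i p.2) =
      Measure.infinitePi μ := by
  refine Measure.eq_infinitePi _ fun s t ht => ?_
  rw [Measure.map_apply (measurable_update_prod i)
    (.pi s.countable_toSet fun j _ => ht j)]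
  -- The constraint at `i` passes to the fresh draw and the others stay on the old point, so the
  -- preimage of a box is a rectangle.
  have hpre : (fun p : (∀ i, X i) × X i => Function.update p.1 i p.2) ⁻¹' (s : Set ι).pi t =
      (((s.erase i : Finset ι) : Set ι).pi t) ×ˢ {z | i ∈ s → z ∈ t i} := by
    ext ⟨x, z⟩
    simp only [Set.mem_preimage, Set.mem_pi, Finset.mem_coe, Set.mem_prod, Finset.mem_erase]
    constructor
    · refine fun h => ⟨fun j hj => ?_, fun hi => ?_⟩
      · simpa [hj.1] using h j hj.2
      · simpa using h i hi
    · rintro ⟨h1, h2⟩ j hj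
      rcases eq_or_ne j i with rfl | hji
      · simpa using h2 hj
      · simpa [hji] using h1 j ⟨hji, hj⟩
  rw [hpre, Measure.prod_prod, Measure.infinitePi_pi _ fun j _ => ht j]
  by_cases hi : i ∈ s
  · simp [hi, Finset.prod_erase_mul]
  · simp [hi]

/-- The inner integral plays the role of the conditional expectation given all coordinates but `i`.
-/
theorem lintegral_infinitePi_update (i : ι) {f : (∀ i, X i) → ENNReal} (hf : Measurable f) :
    ∫⁻ x, f x ∂Measure.infinitePi μ =
      ∫⁻ x, ∫⁻ z, f (Function.update x i z) ∂μ i ∂Measure.infinitePi μ := by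
  conv_lhs => rw [← map_update_infinitePi μ i]
  rw [lintegral_map hf (measurable_update_prod i),
    lintegral_prod (fun p : (∀ i, X i) × X i => f (Function.update p.1 i p.2))
      (hf.comp (measurable_update_prod i)).aemeasurable]

end Resampling

/-! ### Measurability of the switching process -/

section Measurability

variable [MeasurableSpace A] [DiscreteMeasurableSpace A] [Countable A]

theorem measurable_apply_countable {I Z W : Type*} [MeasurableSpace I]
    [DiscreteMeasurableSpace I] [Countable I] [MeasurableSpace Z] [MeasurableSpace W]
    {f : I → Z → W} (hf : ∀ i, Measurable (f i)) {g : Z → I} (hg : Measurable g) :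
    Measurable fun z => f (g z) z :=
  (measurable_from_prod_countable_right (f := fun x : I × Z => f x.1 x.2) hf).comp
    (hg.prodMk measurable_id)

theorem measurable_init {Z : Type*} [MeasurableSpace Z] (t : ℕ) :
    Measurable fun h : Fin (t + 1) → Z => (Fin.init h : Fin t → Z) :=
  measurable_pi_lambda _ fun i => measurable_pi_apply i.castSucc

theorem measurable_snoc {Z : Type*} [MeasurableSpace Z] (t : ℕ) :
    Measurable fun p : (Fin t → Z) × Z =>
      (Fin.snoc (α := fun _ => Z) p.1 p.2 : Fin (t + 1) → Z) := by
  refine measurable_pi_lambda _ fun i => ?_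
  induction i using Fin.lastCases with
  | last => simpa using measurable_snd
  | cast j => simpa using measurable_fst.eval (a := j)

namespace Model

variable {E : Environment A Y} (θ : Model E)

theorem measurable_q_uncurry (ω : θ.params) :
    Measurable fun x : A × Y => θ.q x.1 ω x.2 :=
  measurable_from_prod_countable_right fun a => θ.measurable_q a ω

theorem measurable_likelihood (π₀ : θ.Belief) (t : ℕ) :
    Measurable fun h : Fin t → A × Y => θ.likelihood π₀ h :=
  Finset.measurable_sum _ fun ω _ => (Finset.measurable_prod _ fun τ _ =>
    (θ.measurable_q_uncurry ω).comp (measurable_pi_apply τ)).const_mul _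

theorem measurable_posterior (π₀ : θ.Belief) (t : ℕ) :
    Measurable fun h : Fin t → A × Y => θ.posterior π₀ t h := by
  induction t with
  | zero => exact measurable_const
  | succ t ih =>
    have hb : Measurable fun x : A × (Y × θ.Belief) => θ.bayes x.1 x.2.1 x.2.2 :=
      measurable_from_prod_countable_right θ.measurable_bayes_uncurry
    have hl : Measurable fun h : Fin (t + 1) → A × Y => h (Fin.last t) := measurable_pi_apply _
    exact hb.comp (hl.fst.prodMk (hl.snd.prodMk (ih.comp (measurable_init t))))

end Model

namespace Endowment

variable {E : Environment A Y} (S : Endowment E)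

theorem measurable_modelChoice (t : ℕ) :
    Measurable fun h : Fin t → A × Y => S.modelChoice t h := by
  induction t with
  | zero => exact measurable_const
  | succ t ih =>
    have hm : Measurable fun h : Fin (t + 1) → A × Y => S.modelChoice t (Fin.init h) :=
      ih.comp (measurable_init t)
    have hn : Measurable fun h : Fin (t + 1) → A × Y => !S.modelChoice t (Fin.init h) :=
      (measurable_of_countable not).comp hm
    have hf : Measurable fun h : Fin (t + 1) → A × Y =>
        S.bayesFactor (S.modelChoice t (Fin.init h)) (!S.modelChoice t (Fin.init h)) h :=
      measurable_apply_countable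
        (f := fun m (h : Fin (t + 1) → A × Y) => S.bayesFactor m (!m) h)
        (fun m => ((S.model (!m)).measurable_likelihood (S.prior (!m)) _).div
          ((S.model m).measurable_likelihood (S.prior m) _)) hm
    have hs : MeasurableSet {h : Fin (t + 1) → A × Y | E.α <
        S.bayesFactor (S.modelChoice t (Fin.init h)) (!S.modelChoice t (Fin.init h)) h} :=
      measurableSet_lt measurable_const hf
    simp only [modelChoice]
    exact Measurable.ite hs hn hm

variable {S}

theorem measurable_action (hS : ∀ i, Measurable (S.policy i)) (t : ℕ) :
    Measurable fun h : Fin t → A × Y => S.action t h := by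
  exact measurable_apply_countable (f := fun m (h : Fin t → A × Y) =>
      S.policy m ((S.model m).posterior (S.prior m) t h))
    (fun m => (hS m).comp ((S.model m).measurable_posterior (S.prior m) t))
    (S.measurable_modelChoice t)

theorem measurable_history (hS : ∀ i, Measurable (S.policy i)) (t : ℕ) :
    Measurable fun y => S.history y t := by
  induction t with
  | zero => exact measurable_const
  | succ t ih =>
    have ha := (measurable_action hS t).comp ih
    have hy : Measurable fun x : A × (A × ℕ → Y) => x.2 (x.1, t) :=
      measurable_from_prod_countable_right fun a => measurable_pi_apply (a, t)
    exact (measurable_snoc t).comp (ih.prodMk (ha.prodMk (hy.comp (ha.prodMk measurable_id))))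

end Endowment

end Measurability

/-! ### The likelihood ratio as a martingale -/

section LikelihoodRatio

variable {E : Environment A Y}

/-- The likelihood of a history under a model relative to its true likelihood. -/
def Model.likelihoodRatio (θ : Model E) (π₀ : θ.Belief) {t : ℕ} (h : Fin t → A × Y) : ENNReal :=
  ENNReal.ofReal (θ.likelihood π₀ h / ∏ τ, E.qstar (h τ).1 (h τ).2)

theorem Model.likelihoodRatio_zero (θ : Model E) (π₀ : θ.Belief) (h : Fin 0 → A × Y) :
    θ.likelihoodRatio π₀ h = 1 := by
  have h1 : ∑ ω, π₀.1 ω = 1 := π₀.2.2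
  simp only [Model.likelihoodRatio, Model.likelihood, Finset.univ_eq_empty, Finset.prod_empty,
    mul_one, h1, div_one, ENNReal.ofReal_one]

theorem Environment.prod_qstar_pos {t : ℕ} (h : Fin t → A × Y) :
    0 < ∏ τ, E.qstar (h τ).1 (h τ).2 :=
  Finset.prod_pos fun _ _ => E.qstar_pos _ _

/-- The likelihood ratio is a martingale under the true distribution. -/
theorem Model.lintegral_likelihoodRatio_snoc (θ : Model E) (π₀ : θ.Belief) {t : ℕ}
    (h : Fin t → A × Y) (a : A) :
    ∫⁻ z, θ.likelihoodRatio π₀ (Fin.snoc (α := fun _ => A × Y) h (a, z)) ∂E.Qstar a =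
      θ.likelihoodRatio π₀ h := by
  have hnn : ∀ ω, 0 ≤ π₀.1 ω * (∏ τ, θ.q (h τ).1 ω (h τ).2) /
      ∏ τ, E.qstar (h τ).1 (h τ).2 := fun ω =>
    div_nonneg (mul_nonneg (π₀.2.1 ω) (Finset.prod_nonneg fun _ _ => (θ.q_pos _ _ _).le))
      (E.prod_qstar_pos h).le
  have hd : Measurable fun z => ENNReal.ofReal (E.qstar a z) :=
    (E.measurable_qstar a).ennreal_ofReal
  -- The true density of the new outcome cancels, leaving a combination of the `q a ω z` with
  -- coefficients fixed by the past; each density integrates to one.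
  have hpt (z : Y) : ENNReal.ofReal (E.qstar a z) *
      θ.likelihoodRatio π₀ (Fin.snoc (α := fun _ => A × Y) h (a, z)) =
      ∑ ω, ENNReal.ofReal (π₀.1 ω * (∏ τ, θ.q (h τ).1 ω (h τ).2) /
        ∏ τ, E.qstar (h τ).1 (h τ).2) * ENNReal.ofReal (θ.q a ω z) := by
    rw [Model.likelihoodRatio, ← ENNReal.ofReal_mul (E.qstar_pos a z).le]
    simp_rw [← ENNReal.ofReal_mul (hnn _)]
    rw [← ENNReal.ofReal_sum_of_nonneg fun ω _ => mul_nonneg (hnn ω) (θ.q_pos a ω z).le]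
    congr 1
    have h1 := (E.prod_qstar_pos h).ne'
    have h2 := (E.qstar_pos a z).ne'
    simp only [Model.likelihood, Fin.prod_univ_castSucc, Fin.snoc_castSucc, Fin.snoc_last,
      Finset.sum_div, Finset.mul_sum]
    refine Finset.sum_congr rfl fun ω _ => ?_
    field_simp
  have hmeas : Measurable fun z =>
      θ.likelihoodRatio π₀ (Fin.snoc (α := fun _ => A × Y) h (a, z)) := by
    refine (Measurable.div (Finset.measurable_sum _ fun ω _ => ?_) ?_).ennreal_ofReal
    · simp only [Fin.prod_univ_castSucc, Fin.snoc_castSucc, Fin.snoc_last]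
      exact ((θ.measurable_q a ω).const_mul _).const_mul _
    · simp only [Fin.prod_univ_castSucc, Fin.snoc_castSucc, Fin.snoc_last]
      exact (E.measurable_qstar a).const_mul _
  rw [Environment.Qstar, lintegral_withDensity_eq_lintegral_mul _ hd hmeas]
  simp only [Pi.mul_apply, hpt]
  rw [lintegral_finsetSum _ fun ω _ => (θ.measurable_q a ω).ennreal_ofReal.const_mul _]
  simp_rw [lintegral_const_mul _ (θ.measurable_q a _).ennreal_ofReal, θ.lintegral_q, mul_one]
  rw [← ENNReal.ofReal_sum_of_nonneg fun ω _ => hnn ω, ← Finset.sum_div]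
  rfl

theorem Model.measurable_likelihoodRatio [MeasurableSpace A] [DiscreteMeasurableSpace A]
    [Countable A] (θ : Model E) (π₀ : θ.Belief) (t : ℕ) :
    Measurable fun h : Fin t → A × Y => θ.likelihoodRatio π₀ h := by
  have hq : Measurable fun x : A × Y => E.qstar x.1 x.2 :=
    measurable_from_prod_countable_right E.measurable_qstar
  exact ((θ.measurable_likelihood π₀ t).div (Finset.measurable_prod _ fun τ _ =>
    hq.comp (measurable_pi_apply τ))).ennreal_ofReal

end LikelihoodRatio

/-! ### The realized likelihood ratio and Ville's inequality -/

namespace Endowment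

variable {E : Environment A Y} {S : Endowment E}

/-- Adaptedness: a history of length `s` reads only potential outcomes of periods before `s`, so `s
= t` is allowed. -/
theorem history_update [DecidableEq (A × ℕ)] (y : A × ℕ → Y) (a : A) (t : ℕ) (z : Y) {s : ℕ}
    (hs : s ≤ t) :
    S.history (Function.update y (a, t) z) s = S.history y s := by
  induction s with
  | zero => rfl
  | succ s ih =>
    have hne : (S.action s (S.history y s), s) ≠ (a, t) := fun h => by
      have := congrArg Prod.snd h
      simp only at this
      omega
    simp only [history, ih (by omega), Function.update_of_ne hne]

theorem exists_history_apply_eq (y : A × ℕ → Y) {t : ℕ} (τ : Fin t) :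
    ∃ a, S.history y t τ = (a, y (a, τ)) := by
  induction t with
  | zero => exact τ.elim0
  | succ t ih =>
    induction τ using Fin.lastCases with
    | last => exact ⟨S.action t (S.history y t), by simp [history]⟩
    | cast j => simpa [history] using ih j

/-- The likelihood ratio of model `i` along the realized history. -/
def realizedRatio (S : Endowment E) (i : Bool) (t : ℕ) (y : A × ℕ → Y) : ENNReal :=
  (S.model i).likelihoodRatio (S.prior i) (S.history y t)

theorem realizedRatio_update [DecidableEq (A × ℕ)] (i : Bool) (y : A × ℕ → Y) (a : A) (t : ℕ)
    (z : Y) {s : ℕ} (hs : s ≤ t) :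
    S.realizedRatio i s (Function.update y (a, t) z) = S.realizedRatio i s y := by
  rw [realizedRatio, history_update y a t z hs, realizedRatio]

section Maximal

variable [MeasurableSpace A] [DiscreteMeasurableSpace A] [Countable A]

theorem measurable_realizedRatio (hS : ∀ i, Measurable (S.policy i)) (i : Bool) (t : ℕ) :
    Measurable (S.realizedRatio i t) :=
  ((S.model i).measurable_likelihoodRatio (S.prior i) t).comp (measurable_history hS t)

/-- The martingale property of the likelihood ratio, on events decided by the past. -/
theorem setLIntegral_realizedRatio_succ [DecidableEq (A × ℕ)]
    (hS : ∀ i, Measurable (S.policy i)) (i : Bool) (t : ℕ)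
    {D : Set (A × ℕ → Y)} (hD : MeasurableSet D)
    (hpast : ∀ y a z, Function.update y (a, t) z ∈ D ↔ y ∈ D) :
    ∫⁻ y in D, S.realizedRatio i (t + 1) y ∂E.outcomeLaw =
      ∫⁻ y in D, S.realizedRatio i t y ∂E.outcomeLaw := by
  -- Which coordinate period `t` reveals depends on the action played. Splitting by that action
  -- fixes the coordinate `(a, t)` to resample, and each piece is unaffected by the resampling.
  let C : A → Set (A × ℕ → Y) := fun a => {y | S.action t (S.history y t) = a}
  have hCm : ∀ a, MeasurableSet (C a) := fun a =>
    ((measurable_action hS t).comp (measurable_history hS t)) (MeasurableSet.of_discrete (s := {a}))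
  have hCpast : ∀ a y b z, Function.update y (b, t) z ∈ C a ↔ y ∈ C a := fun a y b z => by
    simp only [C, Set.mem_ofPred_eq, history_update y b t z le_rfl]
  have hU : D = ⋃ a, D ∩ C a := by
    ext y
    simp [C]
  have hdisj : Pairwise (Function.onFun Disjoint fun a => D ∩ C a) := fun a b hab =>
    Set.disjoint_left.2 fun y hy hy' => hab (hy.2.symm.trans hy'.2)
  have hm : ∀ a, MeasurableSet (D ∩ C a) := fun a => hD.inter (hCm a)
  rw [hU, lintegral_iUnion hm hdisj, lintegral_iUnion hm hdisj]
  refine tsum_congr fun a => ?_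
  rw [← lintegral_indicator (hm a), ← lintegral_indicator (hm a), Environment.outcomeLaw,
    lintegral_infinitePi_update (fun j : A × ℕ => E.Qstar j.1) (a, t)
      ((measurable_realizedRatio hS i (t + 1)).indicator (hm a))]
  refine lintegral_congr fun y => ?_
  by_cases hy : y ∈ D ∩ C a
  · have hz : ∀ z, Function.update y (a, t) z ∈ D ∩ C a := fun z =>
      ⟨(hpast y a z).2 hy.1, (hCpast a y a z).2 hy.2⟩
    simp only [Set.indicator_of_mem (hz _), Set.indicator_of_mem hy]
    rw [realizedRatio, ← (S.model i).lintegral_likelihoodRatio_snoc (S.prior i) _ a]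
    refine lintegral_congr fun z => ?_
    have ha : S.action t (S.history y t) = a := hy.2
    simp only [realizedRatio, history, history_update y a t z le_rfl, ha, Function.update_self]
  · have hz : ∀ z, Function.update y (a, t) z ∉ D ∩ C a := fun z h =>
      hy ⟨(hpast y a z).1 h.1, (hCpast a y a z).1 h.2⟩
    simp only [Set.indicator_of_notMem (hz _), Set.indicator_of_notMem hy, lintegral_zero]

/-- The event that the likelihood ratio of model `i` stays below `c` up to time `t`. -/
def belowUntil (S : Endowment E) (i : Bool) (c : ENNReal) (t : ℕ) : Set (A × ℕ → Y) :=
  {y | ∀ s ≤ t, S.realizedRatio i s y < c}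

theorem measurableSet_belowUntil (hS : ∀ i, Measurable (S.policy i)) (i : Bool) (c : ENNReal)
    (t : ℕ) : MeasurableSet (S.belowUntil i c t) := by
  simp only [belowUntil, Set.ofPred_forall]
  exact MeasurableSet.iInter fun s => MeasurableSet.iInter fun _ =>
    measurableSet_lt (measurable_realizedRatio hS i s) measurable_const

instance (E : Environment A Y) : IsProbabilityMeasure E.outcomeLaw :=
  inferInstanceAs (IsProbabilityMeasure (Measure.infinitePi fun i : A × ℕ => E.Qstar i.1))

/-- An optional stopping bound: a path that has crossed is charged `c`, at most its ratio at the
crossing, while the other paths keep their current ratio. The martingale property prevents the total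
from rising above its initial value `1`. -/
theorem setLIntegral_add_mul_measure_compl_belowUntil_le (hS : ∀ i, Measurable (S.policy i))
    (i : Bool) {c : ENNReal} (hc : 1 < c) (t : ℕ) :
    ∫⁻ y in S.belowUntil i c t, S.realizedRatio i t y ∂E.outcomeLaw +
      c * E.outcomeLaw (S.belowUntil i c t)ᶜ ≤ 1 := by
  classical
  induction t with
  | zero =>
    have h0 : ∀ y, S.realizedRatio i 0 y = 1 := fun y => Model.likelihoodRatio_zero _ _ _
    have hU : S.belowUntil i c 0 = Set.univ := by
      ext y
      simp [belowUntil, h0, hc]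
    simp [hU, h0]
  | succ t ih =>
    have hB := measurableSet_belowUntil hS i c t
    have hB' := measurableSet_belowUntil hS i c (t + 1)
    set B := S.belowUntil i c t
    set B' := S.belowUntil i c (t + 1)
    have hsub : B' ⊆ B := fun y hy s hs => hy s (by omega)
    have hstep : ∫⁻ y in B, S.realizedRatio i (t + 1) y ∂E.outcomeLaw =
        ∫⁻ y in B, S.realizedRatio i t y ∂E.outcomeLaw :=
      setLIntegral_realizedRatio_succ hS i t hB fun y a z =>
        forall₂_congr fun s hs => by rw [realizedRatio_update i y a t z hs]
    have hsplit : ∫⁻ y in B, S.realizedRatio i (t + 1) y ∂E.outcomeLaw =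
        ∫⁻ y in B', S.realizedRatio i (t + 1) y ∂E.outcomeLaw +
          ∫⁻ y in B \ B', S.realizedRatio i (t + 1) y ∂E.outcomeLaw := by
      rw [← lintegral_union (hB.diff hB') Set.disjoint_sdiff_right, Set.union_sdiff_cancel hsub]
    have hge : c * E.outcomeLaw (B \ B') ≤
        ∫⁻ y in B \ B', S.realizedRatio i (t + 1) y ∂E.outcomeLaw := by
      rw [← setLIntegral_const]
      -- A path in `B \ B'` crosses for the first time at `t + 1`, so its ratio there is at least
      -- `c`.
      refine setLIntegral_mono (measurable_realizedRatio hS i (t + 1)) fun y hy => ?_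
      by_contra! h
      refine hy.2 fun s hs => ?_
      rcases Nat.le_succ_iff.1 hs with hs | rfl
      · exact hy.1 s hs
      · exact h
    have hcompl : E.outcomeLaw B'ᶜ = E.outcomeLaw Bᶜ + E.outcomeLaw (B \ B') := by
      rw [← measure_union (disjoint_compl_left.mono_right Set.sdiff_subset) (hB.diff hB')]
      congr 1
      ext y
      have := @hsub y
      simp only [Set.mem_compl_iff, Set.mem_union, Set.mem_sdiff]
      tauto
    calc _ = ∫⁻ y in B', S.realizedRatio i (t + 1) y ∂E.outcomeLaw +
          c * E.outcomeLaw (B \ B') + c * E.outcomeLaw Bᶜ := by rw [hcompl]; ring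
      _ ≤ ∫⁻ y in B, S.realizedRatio i t y ∂E.outcomeLaw + c * E.outcomeLaw Bᶜ := by
        rw [← hstep, hsplit]
        gcongr
      _ ≤ 1 := ih

/-- Ville's inequality: with positive probability the likelihood ratio never reaches `c > 1`. -/
theorem measure_forall_realizedRatio_lt_pos (hS : ∀ i, Measurable (S.policy i))
    (i : Bool) {c : ENNReal} (hc : 1 < c) :
    0 < E.outcomeLaw {y | ∀ t, S.realizedRatio i t y < c} := by
  have hset : {y | ∀ t, S.realizedRatio i t y < c} = ⋂ t, S.belowUntil i c t := by
    ext y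
    simp only [belowUntil, Set.mem_iInter, Set.mem_ofPred_eq]
    exact ⟨fun h _ s _ => h s, fun h t => h t t le_rfl⟩
  have hm : MeasurableSet (⋂ t, S.belowUntil i c t) :=
    MeasurableSet.iInter fun t => measurableSet_belowUntil hS i c t
  have hmono : Monotone fun t => (S.belowUntil i c t)ᶜ := fun s t hst =>
    Set.compl_subset_compl.2 fun y hy r hr => hy r (hr.trans hst)
  have hle : E.outcomeLaw (⋂ t, S.belowUntil i c t)ᶜ ≤ c⁻¹ := by
    rw [Set.compl_iInter, hmono.measure_iUnion]
    refine iSup_le fun t => ENNReal.le_inv_iff_mul_le.2 ?_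
    rw [mul_comm]
    exact le_add_self.trans (setLIntegral_add_mul_measure_compl_belowUntil_le hS i hc t)
  rw [hset, pos_iff_ne_zero]
  intro h0
  have h1 := prob_add_prob_compl (μ := E.outcomeLaw) hm
  rw [h0, zero_add] at h1
  rw [h1] at hle
  exact (ENNReal.inv_lt_one.2 hc).not_ge hle

end Maximal

/-! ### From the maximal inequality to persistence -/

/-- There are only countably many potential outcomes, so the exceptional null sets of all actions
and periods can be discarded at once. -/
theorem ae_history_true_density [Countable A] (ω : (S.model false).params)
    (hω : ∀ a, E.qstar a =ᵐ[E.ν] (S.model false).q a ω) :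
    ∀ᵐ y ∂E.outcomeLaw, ∀ t (τ : Fin t), (S.model false).q (S.history y t τ).1 ω
      (S.history y t τ).2 = E.qstar (S.history y t τ).1 (S.history y t τ).2 := by
  have h : ∀ᵐ y ∂E.outcomeLaw, ∀ i : A × ℕ,
      E.qstar i.1 (y i) = (S.model false).q i.1 ω (y i) :=
    ae_all_iff.2 fun i => (measurePreserving_eval_infinitePi
      (fun i : A × ℕ => E.Qstar i.1) i).quasiMeasurePreserving.ae
        ((withDensity_absolutelyContinuous _ _).ae_le (hω i.1))
  filter_upwards [h] with y hy t τ
  obtain ⟨a, ha⟩ := exists_history_apply_eq (S := S) y τ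
  rw [ha]
  exact (hy (a, τ)).symm

/-- Keeping only the term `ω` of the mixture bounds the denominator below by the prior weight times
the true likelihood, which then cancels. -/
theorem bayesFactor_le_of_likelihoodRatio_lt {ω : (S.model false).params}
    (hpos : 1 < E.α * (S.prior false).1 ω) {t : ℕ} {h : Fin t → A × Y}
    (hq : ∀ τ, (S.model false).q (h τ).1 ω (h τ).2 = E.qstar (h τ).1 (h τ).2)
    (hr : (S.model true).likelihoodRatio (S.prior true) h <
      ENNReal.ofReal (E.α * (S.prior false).1 ω)) :
    S.bayesFactor false true h ≤ E.α := by
  have hP := E.prod_qstar_pos h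
  have hα : 0 < E.α := zero_lt_one.trans E.one_lt_α
  rw [Model.likelihoodRatio, ENNReal.ofReal_lt_ofReal_iff (zero_lt_one.trans hpos),
    div_lt_iff₀ hP] at hr
  have hl : (S.prior false).1 ω * ∏ τ, E.qstar (h τ).1 (h τ).2 ≤
      (S.model false).likelihood (S.prior false) h := by
    simp only [← hq]
    exact Finset.single_le_sum (f := fun ω => (S.prior false).1 ω *
      ∏ τ, (S.model false).q (h τ).1 ω (h τ).2) (fun ω _ => mul_nonneg ((S.prior false).2.1 ω)
        (Finset.prod_nonneg fun τ _ => ((S.model false).q_pos _ _ _).le)) (Finset.mem_univ ω)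
  have hω : 0 < (S.prior false).1 ω := pos_of_mul_pos_right (zero_lt_one.trans hpos) hα.le
  rw [bayesFactor, div_le_iff₀ ((mul_pos hω hP).trans_le hl)]
  calc _ ≤ E.α * ((S.prior false).1 ω * ∏ τ, E.qstar (h τ).1 (h τ).2) := by
        rw [← mul_assoc]; exact hr.le
    _ ≤ _ := mul_le_mul_of_nonneg_left hl hα.le

/-- The initial model persists if its prior puts weight above `1 / α` on the truth. -/
theorem initialPersists_of_prior [MeasurableSpace A] [DiscreteMeasurableSpace A] [Countable A]
    (hS : ∀ i, Measurable (S.policy i)) {ω : (S.model false).params}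
    (hω : ∀ a, E.qstar a =ᵐ[E.ν] (S.model false).q a ω)
    (hpos : 1 < E.α * (S.prior false).1 ω) : S.InitialPersists := by
  have hV := measure_forall_realizedRatio_lt_pos hS true (ENNReal.one_lt_ofReal.2 hpos)
  refine hV.trans_le (measure_mono_ae ?_)
  filter_upwards [ae_history_true_density ω hω] with y hy hlt
  -- On this event the initial model is never abandoned, so `T = 0` works.
  refine ⟨0, fun t _ => ?_⟩
  induction t with
  | zero => rfl
  | succ t ih =>
    have hb : S.bayesFactor false true (S.history y (t + 1)) ≤ E.α :=
      bayesFactor_le_of_likelihoodRatio_lt hpos (hy (t + 1)) (hlt (t + 1))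
    have hi : (Fin.init (S.history y (t + 1)) : Fin t → A × Y) = S.history y t :=
      Fin.init_snoc (α := fun _ => A × Y) _ _
    have hm : S.modelChoice t (S.history y t) = false := ih (Nat.zero_le t)
    simp only [modelChoice, hi, hm, Bool.not_false, if_neg hb.not_gt]

end Endowment

/-- There are full-support beliefs with weight arbitrarily close to `1` on a given parameter. -/
theorem Model.exists_fullSupport_lt {E : Environment A Y} (θ : Model E) (ω : θ.params) {r : ℝ}
    (hr0 : 0 < r) (hr : r < 1) : ∃ π : θ.Belief, FullSupport π ∧ r < π.1 ω := by
  classical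
  have hn : (0 : ℝ) < Fintype.card θ.params := by
    exact_mod_cast Fintype.card_pos_iff.2 ⟨ω⟩
  have hε : 0 < (1 - r) / Fintype.card θ.params := div_pos (by linarith) hn
  -- Mass `1 - r` is spread uniformly and the remaining `r` is placed on `ω`.
  refine ⟨⟨fun i => (1 - r) / Fintype.card θ.params + if i = ω then r else 0,
    fun i => ?_, ?_⟩, fun i => ?_, ?_⟩
  · positivity
  · rw [Finset.sum_add_distrib, Finset.sum_const, Finset.sum_ite_eq' Finset.univ ω,
      if_pos (Finset.mem_univ ω), Finset.card_univ, nsmul_eq_mul, mul_div_cancel₀ _ hn.ne']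
    ring
  · change 0 < (1 - r) / Fintype.card θ.params + if i = ω then r else 0
    positivity
  · change r < (1 - r) / Fintype.card θ.params + if ω = ω then r else 0
    rw [if_pos rfl]
    linarith

theorem Model.CorrectlySpecified.globallyRobust [Finite A] [Nonempty A] {E : Environment A Y}
    {θ : Model E} (hθ : θ.CorrectlySpecified) : θ.GloballyRobust := by
  obtain ⟨ω, hω⟩ := hθ
  have hα : 0 < E.α := zero_lt_one.trans E.one_lt_α
  obtain ⟨π, hπ, hlt⟩ := θ.exists_fullSupport_lt ω (inv_pos.2 hα) (inv_lt_one_of_one_lt₀ E.one_lt_α)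
  obtain ⟨p, hp⟩ := θ.exists_isOptimalPolicy
  refine ⟨π, p, hπ, hp, fun θc πc pc _ hpc => ?_⟩
  -- With the discrete σ-algebra on the finite set `A`, measurable level sets make a policy a
  -- measurable map.
  let : MeasurableSpace A := ⊤
  have : DiscreteMeasurableSpace A := ⟨fun _ => trivial⟩
  refine Endowment.initialPersists_of_prior (S := Endowment.pair θ θc π πc p pc) (ω := ω)
    (fun i => ?_) hω ((inv_lt_iff_one_lt_mul₀' hα).1 hlt)
  cases i with
  | false => exact measurable_to_countable' hp.1
  | true => exact measurable_to_countable' hpc.1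

end Switcher

end

theorem corollary1 {A : Type*} [Finite A] [Nonempty A] {k : ℕ}
    (Y : Set (EuclideanSpace ℝ (Fin k))) (hY : Y = Set.univ ∨ IsCompact Y)
    (E : Switcher.Environment A Y) (θ : Switcher.Model E)
    (hθ : θ.CorrectlySpecified) :
    θ.GloballyRobust :=
  hθ.globallyRobust
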